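/- All graphs are finite and simple. A bipartite graph $H$ is *peanut-like with foci* $u,v$ if its vertex set has a bipartition $V(H)=A\sqcup B$ (every edge joins $A$ and $B$) with $u\in B$, $v\in A$, $N(u)=A\setminus\{v\}$ and $N(v)=B\setminus\{u\}$. A *$uv$-separator* of $H$ is a set $S\subseteq V(H)\setminus\{u,v\}$ such that $u$ and $v$ are not connected by a path in $H-S$. Two vertex sets $S,S'$ are adjacent under token jumping (TJ) if $|S|=|S'|$ and $|S\setminus S'|=|S'\setminus S|=1$; for a nonnegative integer $k$ they are adjacent under $k$-token addition/removal ($k$-TAR) if $|S\mathbin{\triangle}S'|=1$ and $\max(|S|,|S'|)\le k$. A *reconfiguration sequence* of length $\ell$ from $S_a$ to $S_b$ under one of these rules is a sequence $\langle S_1,\dots,S_\ell\rangle$ of $uv$-separators with $S_1=S_a$, $S_\ell=S_b$ in which consecutive sets are adjacent under the rule; if one exists, $S_a$ *can be reconfigured* into $S_b$ under that rule. **Corollary.** There is an absolute constant $C$ such that the following holds. Let $H$ be an $n$-vertex peanut-like bipartite graph with foci $u,v$, and let $S_a,S_b$ be two $uv$-separators of $H$. If $S_a$ can be reconfigured into $S_b$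 under TJ, then there is a reconfiguration sequence from $S_a$ to $S_b$ under TJ of length at most $Cn^4$. For every integer $k\ge 0$, if $S_a$ can be reconfigured into $S_b$ under $k$-TAR, then there is a reconfiguration sequence from $S_a$ to $S_b$ under $k$-TAR of length at most $Cn^4$. -/

import Mathlib

namespace SeparatorReconfig

/-- `G` is a bipartite graph with partition `V = A ∪ B` which is peanut-like with foci `u ∈ B` and
`v ∈ A`: `N(u) = A \ {v}` and `N(v) = B \ {u}`. -/
structure IsPeanutLikeWith {V : Type*} (G : SimpleGraph V) (A B : Set V) (u v : V) : Prop where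
  bipartite : G.IsBipartiteWith A B
  cover : A ∪ B = Set.univ
  mem_left : u ∈ B
  mem_right : v ∈ A
  neighbors_left : G.neighborSet u = A \ {v}
  neighbors_right : G.neighborSet v = B \ {u}

/-- `G` is a peanut-like bipartite graph with foci `u`, `v` (for some bipartition). -/
def IsPeanutLike {V : Type*} (G : SimpleGraph V) (u v : V) : Prop :=
  ∃ A B : Set V, IsPeanutLikeWith G A B u v

/-- `S ⊆ V(G) \ {s, t}` is an `st`-separator: in the subgraph `G - S` induced by the vertices
outside `S` there is no path between `s` and `t`. (This forces `s ≠ t` and `s`, `t` non-adjacent.) -/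
def IsSeparator {V : Type*} (G : SimpleGraph V) (s t : V) (S : Finset V) : Prop :=
  ∃ (hs : s ∉ S) (ht : t ∉ S), ¬ (G.induce {x | x ∉ S}).Reachable ⟨s, hs⟩ ⟨t, ht⟩

/-- Token jumping: one vertex of `S` is replaced by one vertex outside `S`. -/
def TJ {V : Type*} [DecidableEq V] (S T : Finset V) : Prop :=
  S.card = T.card ∧ (S \ T).card = 1 ∧ (T \ S).card = 1

/-- `k`-token addition/removal: one vertex is added or removed, and no set has more than `k`
vertices. -/
def TAR {V : Type*} [DecidableEq V] (k : ℕ) (S T : Finset V) : Prop :=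
  ((S \ T) ∪ (T \ S)).card = 1 ∧ max S.card T.card ≤ k

/-- The list `L = ⟨S₁, …, Sₗ⟩` is a reconfiguration sequence of `st`-separators from `S` to `T`
under the rule `R`. Its length is the number `ℓ` of its members. -/
structure IsReconfigSeq {V : Type*} (G : SimpleGraph V) (s t : V)
    (R : Finset V → Finset V → Prop) (S T : Finset V) (L : List (Finset V)) : Prop where
  separator : ∀ X ∈ L, IsSeparator G s t X
  chain : L.IsChain R
  head : L.head? = some S
  last : L.getLast? = some T

/-- `S` can be reconfigured into `T` under the rule `R`. -/
def Reconfigurable {V : Type*} (G : SimpleGraph V) (s t : V)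
    (R : Finset V → Finset V → Prop) (S T : Finset V) : Prop :=
  ∃ L : List (Finset V), IsReconfigSeq G s t R S T L

end SeparatorReconfig

open scoped symmDiff

namespace SeparatorReconfig

/-! Complementing a separator `S` on the side `B`, that is, passing to `D = S ∆ B`, turns "every
edge between non-foci meets `S`" into the implication "`b ∈ D` forces `a ∈ D`". Such families are
closed under union and intersection, and `|S| = |D ∆ B|` is modular in `D`
(`IsPeanutLikeWith.isSetLattice`, `isModular_card_symmDiff`). So TAR becomes a walk in a set lattice
under a cost cap. In such a lattice a walk upward from the bottom element can be made monotone,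
hence of at most `n` steps (`exists_monotone_crusade`). Uncrossing a walk from `X` against `X`
itself shows that any improvement can be found by going only up or only down, so a local minimum is
reached after at most `n` improvements of at most `n` steps each. Two connected local minima `X`,
`Y` meet in `X ∪ Y` (`IsLocalMin.reachIn_union`). This gives O(n²) steps
(`reachIn_of_reflTransGen`). A TJ sequence of sets of size `k` is a TAR sequence with cap `k + 1`.
Conversely, each set of a short TAR sequence is padded or trimmed to size `k`, at most `n` jumps per
step (`reachIn_jumpStep`). -/

/-- `ReachIn r m x y`: one gets from `x` to `y` in at most `m` steps of `r`. -/
inductive ReachIn {α : Type*} (r : α → α → Prop) : ℕ → α → α → Prop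
  | refl (m : ℕ) (x : α) : ReachIn r m x x
  | head {m : ℕ} {x y z : α} : r x y → ReachIn r m y z → ReachIn r (m + 1) x z

namespace ReachIn

variable {α β : Type*} {r : α → α → Prop} {s : β → β → Prop} {m n : ℕ} {x y z : α}

theorem mono (h : ReachIn r m x y) : ∀ {n : ℕ}, m ≤ n → ReachIn r n x y := by
  induction h with
  | refl m x => exact fun _ => .refl _ _
  | head hr _ ih =>
    rintro (_ | n) hn
    · omega
    · exact .head hr (ih (by omega))

theorem trans (h : ReachIn r m x y) (h' : ReachIn r n y z) : ReachIn r (m + n) x z := by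
  induction h with
  | refl m x => exact h'.mono (by omega)
  | head hr _ ih => exact (ReachIn.head hr (ih h')).mono (by omega)

theorem single (h : r x y) : ReachIn r 1 x y := .head h (.refl 0 y)

theorem map (g : α → β) (hg : ∀ a b, r a b → s (g a) (g b)) (h : ReachIn r m x y) :
    ReachIn s m (g x) (g y) := by
  induction h with
  | refl m x => exact .refl _ _
  | head hr _ ih => exact .head (hg _ _ hr) ih

theorem symm (hr : ∀ a b, r a b → r b a) (h : ReachIn r m x y) : ReachIn r m y x := by
  induction h with
  | refl m x => exact .refl _ _
  | head hxy _ ih => exact ih.trans (.single (hr _ _ hxy))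

theorem reflTransGen (h : ReachIn r m x y) : Relation.ReflTransGen r x y := by
  induction h with
  | refl m x => exact .refl
  | head hr _ ih => exact .head hr ih

end ReachIn

theorem exists_seq_of_reflTransGen {α : Type*} {r : α → α → Prop} {x y : α}
    (h : Relation.ReflTransGen r x y) :
    ∃ (m : ℕ) (f : ℕ → α), f 0 = x ∧ f m = y ∧ ∀ i < m, r (f i) (f (i + 1)) := by
  induction h using Relation.ReflTransGen.head_induction_on with
  | refl => exact ⟨0, fun _ => y, rfl, rfl, by simp⟩
  | @head a c hac _ ih =>
    obtain ⟨m, f, h0, hm, hf⟩ := ih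
    refine ⟨m + 1, fun i => Nat.casesOn i a f, rfl, hm, ?_⟩
    rintro (_ | i) hi
    · simpa [h0] using hac
    · exact hf i (by omega)

/-! ### Set lattices with modular cost: monotone walks -/

section Lattice

variable {α : Type*} [DecidableEq α]

/-- Both sets satisfy `P`, and they differ in at most one element. -/
def Step (P : Finset α → Prop) (X Y : Finset α) : Prop :=
  P X ∧ P Y ∧ (X ∆ Y).card ≤ 1

theorem Step.symm {P : Finset α → Prop} {X Y : Finset α} (h : Step P X Y) : Step P Y X :=
  ⟨h.2.1, h.1, symmDiff_comm X Y ▸ h.2.2⟩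

theorem Step.mono {P Q : Finset α → Prop} (h : ∀ X, P X → Q X) {X Y : Finset α}
    (hs : Step P X Y) : Step Q X Y :=
  ⟨h _ hs.1, h _ hs.2.1, hs.2.2⟩

theorem Step.reflTransGen_symm {P : Finset α → Prop} {X Y : Finset α}
    (h : Relation.ReflTransGen (Step P) X Y) : Relation.ReflTransGen (Step P) Y X :=
  haveI : Std.Symm (Step P) := ⟨fun _ _ => Step.symm⟩
  Relation.ReflTransGen.stdSymm.symm _ _ h

theorem Step.reflTransGen_mono {P Q : Finset α → Prop} (h : ∀ X, P X → Q X) {X Y : Finset α}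
    (hs : Relation.ReflTransGen (Step P) X Y) : Relation.ReflTransGen (Step Q) X Y :=
  hs.lift id fun _ _ => Step.mono h

theorem Step.reflTransGen_right {P : Finset α → Prop} {X Y : Finset α} (hX : P X)
    (h : Relation.ReflTransGen (Step P) X Y) : P Y := by
  induction h with
  | refl => exact hX
  | tail _ hs _ => exact hs.2.1

/-- A family of sets closed under unions and intersections. -/
def IsSetLattice (F : Finset α → Prop) : Prop :=
  ∀ X Y, F X → F Y → F (X ∪ Y) ∧ F (X ∩ Y)

/-- A modular set function. -/
def IsModular (f : Finset α → ℕ) : Prop :=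
  ∀ X Y, f (X ∪ Y) + f (X ∩ Y) = f X + f Y

theorem IsSetLattice.above {F : Finset α → Prop} (hF : IsSetLattice F) (X : Finset α) :
    IsSetLattice (fun D => F D ∧ X ⊆ D) := fun A B hA hB =>
  ⟨⟨(hF A B hA.1 hB.1).1, hA.2.trans Finset.subset_union_left⟩,
    (hF A B hA.1 hB.1).2, Finset.subset_inter hA.2 hB.2⟩

theorem IsSetLattice.below {F : Finset α → Prop} (hF : IsSetLattice F) (X : Finset α) :
    IsSetLattice (fun D => F D ∧ D ⊆ X) := fun A B hA hB =>
  ⟨⟨(hF A B hA.1 hB.1).1, Finset.union_subset hA.2 hB.2⟩,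
    (hF A B hA.1 hB.1).2, Finset.inter_subset_left.trans hA.2⟩

/-- The sets of `F` of cost at most `k`. -/
def Cheap (F : Finset α → Prop) (f : Finset α → ℕ) (k : ℕ) (X : Finset α) : Prop :=
  F X ∧ f X ≤ k

theorem card_union_symmDiff_le (X A B : Finset α) : ((X ∪ A) ∆ (X ∪ B)).card ≤ (A ∆ B).card := by
  refine Finset.card_le_card fun x hx => ?_
  simp only [Finset.mem_symmDiff, Finset.mem_union] at hx ⊢
  tauto

theorem card_inter_symmDiff_le (X A B : Finset α) : ((X ∩ A) ∆ (X ∩ B)).card ≤ (A ∆ B).card := by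
  refine Finset.card_le_card fun x hx => ?_
  simp only [Finset.mem_symmDiff, Finset.mem_inter] at hx ⊢
  tauto

/-- Sequences of cheap sets, in which each set has at most one new element, from `X` to a superset
of `Y` that costs at most as much as `Y`. -/
structure IsCrusade (F : Finset α → Prop) (f : Finset α → ℕ) (k m : ℕ) (X Y : Finset α)
    (y : ℕ → Finset α) : Prop where
  start : y 0 = X
  sub : Y ⊆ y m
  cost : f (y m) ≤ f Y
  cheap : ∀ i ≤ m, Cheap F f k (y i)
  step : ∀ i < m, (y (i + 1) \ y i).card ≤ 1

variable [Fintype α]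

/-- Among crusades of fixed length, one of minimal total weight is monotone: otherwise replacing `y
(i + 1)` by a union or `y i` by an intersection would lower the weight. -/
theorem exists_monotone_crusade {F : Finset α → Prop} {f : Finset α → ℕ} (hF : IsSetLattice F)
    (hf : IsModular f) {k m : ℕ} {X Y : Finset α} (hX : ∀ D, F D → X ⊆ D) {y₀ : ℕ → Finset α}
    (hy₀ : IsCrusade F f k m X Y y₀) :
    ∃ y, IsCrusade F f k m X Y y ∧ ∀ i < m, y i ⊆ y (i + 1) := by
  classical
  -- The factor exceeds every cardinality, so `w` compares cost first and size second.
  let w : Finset α → ℕ := fun D => (Fintype.card α + 1) * f D + D.card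
  let W : (ℕ → Finset α) → ℕ := fun y => ∑ i ∈ Finset.range (m + 1), w (y i)
  obtain ⟨y, hy, hmin⟩ := (measure W).wf.has_min {y | IsCrusade F f k m X Y y} ⟨y₀, hy₀⟩
  replace hy : IsCrusade F f k m X Y y := hy
  refine ⟨y, hy, fun i hi => ?_⟩
  have key : ∀ j ≤ m, ∀ D, IsCrusade F f k m X Y (Function.update y j D) → w (y j) ≤ w D := by
    intro j hj D hD
    have h1 : W y ≤ W (Function.update y j D) := not_lt.1 (hmin _ hD)
    have hj' : j ∈ Finset.range (m + 1) := by simp; omega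
    have h2 : W (Function.update y j D) =
        w D + ∑ i ∈ (Finset.range (m + 1)).erase j, w (y i) := by
      change ∑ i ∈ Finset.range (m + 1), _ = _
      rw [← Finset.add_sum_erase _ _ hj']
      congr 1
      · simp
      · refine Finset.sum_congr rfl fun a ha => ?_
        rw [Function.update_of_ne (Finset.ne_of_mem_erase ha)]
    have h3 : W y = w (y j) + ∑ i ∈ (Finset.range (m + 1)).erase j, w (y i) :=
      (Finset.add_sum_erase _ _ hj').symm
    omega
  have hcard : ∀ D : Finset α, D.card ≤ Fintype.card α := fun D => Finset.card_le_univ D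
  have cost_le : ∀ A B : Finset α, w A ≤ w B → f A ≤ f B := by
    intro A B h
    by_contra! hlt
    have h1 := hcard B
    have h2 : (Fintype.card α + 1) * (f B + 1) ≤ (Fintype.card α + 1) * f A :=
      Nat.mul_le_mul_left _ hlt
    simp only [w] at h
    rw [mul_add] at h2
    omega
  have ci := hy.cheap i hi.le
  have cj := hy.cheap (i + 1) hi
  have hmod := hf (y i) (y (i + 1))
  have hlat := hF _ _ ci.1 cj.1
  -- Otherwise modularity makes the union cheaper than `y (i + 1)`. The substitution is allowed even
  -- at the end, where only a superset of `Y` of no greater cost is required.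
  have hmeet : f (y i ∩ y (i + 1)) ≤ f (y i) := by
    by_contra! hlt
    have hlt' : f (y i ∪ y (i + 1)) < f (y (i + 1)) := by omega
    refine absurd (cost_le _ _ (key (i + 1) hi (y i ∪ y (i + 1)) ?_)) (by omega)
    refine ⟨by simp [hy.start], ?_, ?_, ?_, ?_⟩
    · rcases eq_or_ne m (i + 1) with rfl | h
      · simpa using hy.sub.trans Finset.subset_union_right
      · simpa [Function.update_of_ne h] using hy.sub
    · rcases eq_or_ne m (i + 1) with rfl | h
      · simpa using hlt'.le.trans hy.cost
      · simpa [Function.update_of_ne h] using hy.cost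
    · intro j hj
      rcases eq_or_ne j (i + 1) with rfl | h
      · simpa using ⟨hlat.1, hlt'.le.trans cj.2⟩
      · simpa [Function.update_of_ne h] using hy.cheap j hj
    · intro j hj
      refine le_trans (Finset.card_le_card ?_) (hy.step j hj)
      rcases eq_or_ne j (i + 1) with rfl | h
      · simp only [Function.update_self, Function.update_of_ne (Nat.succ_ne_self (i + 1))]
        exact Finset.sdiff_subset_sdiff le_rfl Finset.subset_union_right
      · rcases eq_or_ne j i with rfl | h'
        · simp [Finset.union_sdiff_left]
        · rw [Function.update_of_ne h, Function.update_of_ne (by omega)]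
  -- At `i = 0` the intersection is still `X`, because `X` is the bottom of `F`.
  have hw := key i hi.le (y i ∩ y (i + 1)) (by
    refine ⟨?_, ?_, ?_, ?_, ?_⟩
    · rcases eq_or_ne i 0 with rfl | h
      · simpa [hy.start] using hX _ cj.1
      · simpa [Function.update_of_ne h.symm] using hy.start
    · simpa [Function.update_of_ne hi.ne'] using hy.sub
    · simpa [Function.update_of_ne hi.ne'] using hy.cost
    · intro j hj
      rcases eq_or_ne j i with rfl | h
      · simpa using ⟨hlat.2, hmeet.trans ci.2⟩
      · simpa [Function.update_of_ne h] using hy.cheap j hj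
    · intro j hj
      refine le_trans (Finset.card_le_card ?_) (hy.step j hj)
      rcases eq_or_ne j i with rfl | h
      · simp only [Function.update_self, Function.update_of_ne (Nat.succ_ne_self j)]
        simp
      · rw [Function.update_of_ne h]
        rcases eq_or_ne (j + 1) i with rfl | h'
        · rw [Function.update_self]
          exact Finset.sdiff_subset_sdiff Finset.inter_subset_left le_rfl
        · rw [Function.update_of_ne h'])
  have hfe : f (y i) = f (y i ∩ y (i + 1)) := le_antisymm (cost_le _ _ hw) hmeet
  have hc : (y i).card ≤ (y i ∩ y (i + 1)).card := by
    simp only [w, ← hfe] at hw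
    omega
  exact Finset.inter_eq_left.1 (Finset.eq_of_subset_of_card_le Finset.inter_subset_left hc)

/-- In a monotone crusade each step either does nothing or adds one element, so the size of the
current set bounds the number of genuine steps. -/
theorem exists_short_up {F : Finset α → Prop} {f : Finset α → ℕ} (hF : IsSetLattice F)
    (hf : IsModular f) {k : ℕ} {X Y : Finset α} (hX : ∀ D, F D → X ⊆ D)
    (hc : Cheap F f k X) (h : Relation.ReflTransGen (Step (Cheap F f k)) X Y) :
    ∃ Z, Y ⊆ Z ∧ f Z ≤ f Y ∧ Cheap F f k Z ∧
      ReachIn (Step (Cheap F f k)) (Fintype.card α) X Z := by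
  obtain ⟨m, y₀, h0, hm, hs⟩ := exists_seq_of_reflTransGen h
  obtain ⟨y, hy, hmono⟩ := exists_monotone_crusade (k := k) (m := m) (Y := Y) hF hf hX (y₀ := y₀)
    ⟨h0, hm.ge, by rw [hm], by
      rintro (_ | i) hi
      · rwa [h0]
      · exact (hs i hi).2.1, fun i hi =>
        (Finset.card_le_card (by rw [symmDiff_comm]; exact Finset.subset_union_left)).trans
          (hs i hi).2.2⟩
  have key : ∀ i ≤ m, ReachIn (Step (Cheap F f k)) (y i).card X (y i) := by
    intro i
    induction i with
    | zero => intro _; rw [hy.start]; exact .refl _ _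
    | succ i ih =>
      intro hi
      have hsub := hmono i hi
      have hst := hy.step i hi
      have hcs := Finset.card_sdiff_add_card_eq_card hsub
      have hih := ih (by omega)
      rcases Nat.lt_or_ge (y i).card (y (i + 1)).card with hlt | hge
      · refine (hih.trans (.single ⟨hy.cheap i (by omega), hy.cheap _ hi, ?_⟩)).mono hlt
        rwa [symmDiff_of_le hsub]
      · rwa [← Finset.eq_of_subset_of_card_le hsub hge]
  exact ⟨y m, hy.sub, hy.cost, hy.cheap m le_rfl, (key m le_rfl).mono (Finset.card_le_univ _)⟩

end Lattice
end SeparatorReconfig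

namespace SeparatorReconfig
-- Local minima and the quadratic bound
section Lattice

variable {α : Type*} [DecidableEq α]

/-- No cheap set that can be reached from `X` costs less than `X`. -/
def IsLocalMin (F : Finset α → Prop) (f : Finset α → ℕ) (k : ℕ) (X : Finset α) : Prop :=
  ∀ Y, Relation.ReflTransGen (Step (Cheap F f k)) X Y → f X ≤ f Y

/-- Along the walk, `f (X ∪ D) + f (X ∩ D) = f X + f D`. While both terms on the left are at least
`f X`, both are at most `f D ≤ k`, so both projected walks stay cheap. The first time one drops
below `f X`, it is an improvement above or below `X`. -/
theorem improve_or_reach_union_inter {F : Finset α → Prop} {f : Finset α → ℕ}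
    (hF : IsSetLattice F) (hf : IsModular f) {k : ℕ} {X Y : Finset α} (hX : Cheap F f k X)
    (h : Relation.ReflTransGen (Step (Cheap F f k)) X Y) :
    (∃ Z, f Z < f X ∧
      Relation.ReflTransGen (Step (Cheap (fun D => F D ∧ X ⊆ D) f k)) X Z) ∨
    (∃ Z, f Z < f X ∧
      Relation.ReflTransGen (Step (Cheap (fun D => F D ∧ D ⊆ X) f k)) X Z) ∨
    (f X ≤ f (X ∪ Y) ∧ f X ≤ f (X ∩ Y) ∧
      Relation.ReflTransGen (Step (Cheap (fun D => F D ∧ X ⊆ D) f k)) X (X ∪ Y) ∧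
      Relation.ReflTransGen (Step (Cheap (fun D => F D ∧ D ⊆ X) f k)) X (X ∩ Y)) := by
  induction h with
  | refl =>
    refine .inr (.inr ?_)
    simp only [Finset.union_self, Finset.inter_self, le_refl, true_and]
    exact ⟨.refl, .refl⟩
  | @tail B D _ hs ih =>
    rcases ih with h | h | ⟨h1, h2, hu, hd⟩
    · exact .inl h
    · exact .inr (.inl h)
    · obtain ⟨hB, hD, hBD⟩ := hs
      have mB := hf X B
      have mD := hf X D
      have lB := hF X B hX.1 hB.1
      have lD := hF X D hX.1 hD.1
      have kX := hX.2
      have kB := hB.2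
      have kD := hD.2
      have up : f (X ∪ D) ≤ k →
          Relation.ReflTransGen (Step (Cheap (fun D => F D ∧ X ⊆ D) f k)) X (X ∪ D) := fun hk =>
        hu.tail ⟨⟨⟨lB.1, Finset.subset_union_left⟩, by omega⟩,
          ⟨⟨lD.1, Finset.subset_union_left⟩, hk⟩, (card_union_symmDiff_le X B D).trans hBD⟩
      have down : f (X ∩ D) ≤ k →
          Relation.ReflTransGen (Step (Cheap (fun D => F D ∧ D ⊆ X) f k)) X (X ∩ D) := fun hk =>
        hd.tail ⟨⟨⟨lB.2, Finset.inter_subset_left⟩, by omega⟩,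
          ⟨⟨lD.2, Finset.inter_subset_left⟩, hk⟩, (card_inter_symmDiff_le X B D).trans hBD⟩
      rcases Nat.lt_or_ge (f (X ∪ D)) (f X) with hlt | hge
      · exact .inl ⟨_, hlt, up (by omega)⟩
      · rcases Nat.lt_or_ge (f (X ∩ D)) (f X) with hlt' | hge'
        · exact .inr (.inl ⟨_, hlt', down (by omega)⟩)
        · exact .inr (.inr ⟨hge, hge', up (by omega), down (by omega)⟩)

theorem IsLocalMin.reach_union_inter {F : Finset α → Prop} {f : Finset α → ℕ}
    (hF : IsSetLattice F) (hf : IsModular f) {k : ℕ} {X Y : Finset α} (hX : Cheap F f k X)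
    (hmin : IsLocalMin F f k X) (h : Relation.ReflTransGen (Step (Cheap F f k)) X Y) :
    f X ≤ f (X ∪ Y) ∧ f X ≤ f (X ∩ Y) ∧
      Relation.ReflTransGen (Step (Cheap (fun D => F D ∧ X ⊆ D) f k)) X (X ∪ Y) ∧
      Relation.ReflTransGen (Step (Cheap (fun D => F D ∧ D ⊆ X) f k)) X (X ∩ Y) := by
  rcases improve_or_reach_union_inter hF hf hX h with ⟨Z, hlt, hZ⟩ | ⟨Z, hlt, hZ⟩ | h
  · exact absurd (hmin Z (Step.reflTransGen_mono (fun _ h => ⟨h.1.1, h.2⟩) hZ)) (by omega)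
  · exact absurd (hmin Z (Step.reflTransGen_mono (fun _ h => ⟨h.1.1, h.2⟩) hZ)) (by omega)
  · exact h

variable [Fintype α]

/-- The order dual of `exists_short_up`, by complementation. -/
theorem exists_short_down {F : Finset α → Prop} {f : Finset α → ℕ} (hF : IsSetLattice F)
    (hf : IsModular f) {k : ℕ} {X Y : Finset α} (hX : ∀ D, F D → D ⊆ X)
    (hc : Cheap F f k X) (h : Relation.ReflTransGen (Step (Cheap F f k)) X Y) :
    ∃ Z, Z ⊆ Y ∧ f Z ≤ f Y ∧ Cheap F f k Z ∧
      ReachIn (Step (Cheap F f k)) (Fintype.card α) X Z := by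
  have hcompl : ∀ A B : Finset α, Aᶜ ∆ Bᶜ = A ∆ B := compl_symmDiff_compl
  obtain ⟨Z, h1, h2, h3, h4⟩ := exists_short_up (F := fun D => F Dᶜ) (f := fun D => f Dᶜ)
    (k := k) (X := Xᶜ) (Y := Yᶜ)
    (fun A B hA hB => by
      have := hF _ _ hA hB
      simpa only [Finset.compl_union, Finset.compl_inter] using this.symm)
    (fun A B => by
      have := hf Aᶜ Bᶜ
      simp only [Finset.compl_union, Finset.compl_inter]
      omega)
    (fun D hD => by
      have := Finset.compl_subset_compl.2 (hX _ hD)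
      rwa [compl_compl] at this)
    (by simpa [Cheap] using hc)
    (h.lift (fun D => Dᶜ) fun A B hAB => by
      refine ⟨by simpa [Cheap] using hAB.1, by simpa [Cheap] using hAB.2.1, ?_⟩
      rw [hcompl]; exact hAB.2.2)
  refine ⟨Zᶜ, ?_, ?_, h3, ?_⟩
  · have := Finset.compl_subset_compl.2 h1
    rwa [compl_compl] at this
  · simpa using h2
  · have := h4.map (s := Step (Cheap F f k)) (fun D => Dᶜ) fun A B hAB =>
      ⟨hAB.1, hAB.2.1, by rw [hcompl]; exact hAB.2.2⟩
    rwa [compl_compl] at this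

theorem exists_short_improvement {F : Finset α → Prop} {f : Finset α → ℕ} (hF : IsSetLattice F)
    (hf : IsModular f) {k : ℕ} {X : Finset α} (hX : Cheap F f k X)
    (hmin : ¬ IsLocalMin F f k X) :
    ∃ Z, f Z < f X ∧ Cheap F f k Z ∧
      ReachIn (Step (Cheap F f k)) (Fintype.card α) X Z := by
  simp only [IsLocalMin, not_forall, not_le] at hmin
  obtain ⟨Y, hY, hlt⟩ := hmin
  rcases improve_or_reach_union_inter hF hf hX hY with ⟨Z, hZ, h⟩ | ⟨Z, hZ, h⟩ | h
  · obtain ⟨Z', -, h1, h2, h3⟩ := exists_short_up (hF.above X) hf (fun _ h => h.2)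
      ⟨⟨hX.1, subset_rfl⟩, hX.2⟩ h
    exact ⟨Z', by omega, ⟨h2.1.1, h2.2⟩,
      h3.map id fun _ _ => Step.mono fun _ h => ⟨h.1.1, h.2⟩⟩
  · obtain ⟨Z', -, h1, h2, h3⟩ := exists_short_down (hF.below X) hf (fun _ h => h.2)
      ⟨⟨hX.1, subset_rfl⟩, hX.2⟩ h
    exact ⟨Z', by omega, ⟨h2.1.1, h2.2⟩,
      h3.map id fun _ _ => Step.mono fun _ h => ⟨h.1.1, h.2⟩⟩
  -- Here modularity would give `f Y ≥ f X`.
  · have := hf X Y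
    omega

theorem exists_reach_isLocalMin {F : Finset α → Prop} {f : Finset α → ℕ} (hF : IsSetLattice F)
    (hf : IsModular f) {k : ℕ} (c : ℕ) : ∀ X, f X ≤ c → Cheap F f k X →
    ∃ Z, Cheap F f k Z ∧ IsLocalMin F f k Z ∧
      ReachIn (Step (Cheap F f k)) (c * Fintype.card α) X Z := by
  induction c with
  | zero => exact fun X h hX => ⟨X, hX, fun Y _ => by omega, .refl _ _⟩
  | succ c ih =>
    intro X hle hX
    by_cases hmin : IsLocalMin F f k X
    · exact ⟨X, hX, hmin, .refl _ _⟩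
    · obtain ⟨Y, hlt, hY, hXY⟩ := exists_short_improvement hF hf hX hmin
      obtain ⟨Z, hZ, hZmin, hYZ⟩ := ih Y (by omega) hY
      exact ⟨Z, hZ, hZmin, (hXY.trans hYZ).mono (by rw [Nat.succ_mul, add_comm])⟩

/-- The union costs as much as `X`, so it is a local minimum among the sets above `X`. Projecting
the walk a second time, now under `X ∪ Y`, confines it to the interval from `X` to `X ∪ Y`, where a
short upward walk can only end at the top. -/
theorem IsLocalMin.reachIn_union {F : Finset α → Prop} {f : Finset α → ℕ} (hF : IsSetLattice F)
    (hf : IsModular f) {k : ℕ} {X Y : Finset α} (hX : Cheap F f k X)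
    (hmX : IsLocalMin F f k X) (hmY : IsLocalMin F f k Y)
    (h : Relation.ReflTransGen (Step (Cheap F f k)) X Y) :
    ReachIn (Step (Cheap F f k)) (Fintype.card α) X (X ∪ Y) := by
  obtain ⟨h1, h2, hu, -⟩ := hmX.reach_union_inter hF hf hX h
  have hXY : f X = f Y := le_antisymm (hmX Y h) (hmY X (Step.reflTransGen_symm h))
  have hmod := hf X Y
  have hT : f (X ∪ Y) = f X := by omega
  have hcX : Cheap (fun D => F D ∧ X ⊆ D) f k X := ⟨⟨hX.1, subset_rfl⟩, hX.2⟩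
  have hcT := Step.reflTransGen_right hcX hu
  have hmT : IsLocalMin (fun D => F D ∧ X ⊆ D) f k (X ∪ Y) := fun Z hZ => by
    rw [hT]
    exact hmX Z (Step.reflTransGen_mono (fun _ h => ⟨h.1.1, h.2⟩) (hu.trans hZ))
  obtain ⟨-, -, -, hd⟩ := hmT.reach_union_inter (hF.above X) hf hcT (Step.reflTransGen_symm hu)
  rw [Finset.union_inter_cancel_left] at hd
  obtain ⟨Z, hTZ, -, hZ, hr⟩ := exists_short_up ((hF.above X).below (X ∪ Y)) hf
    (fun _ h => h.1.2) ⟨⟨hcX.1, Finset.subset_union_left⟩, hX.2⟩ (Step.reflTransGen_symm hd)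
  obtain rfl := Finset.Subset.antisymm hTZ hZ.1.2
  exact hr.map id fun _ _ => Step.mono fun _ h => ⟨h.1.1.1, h.2⟩

/-- In a family of sets closed under unions and intersections, with a modular cost, two cheap sets
are either disconnected or at polynomial distance. -/
theorem reachIn_of_reflTransGen {F : Finset α → Prop} {f : Finset α → ℕ} (hF : IsSetLattice F)
    (hf : IsModular f) {c : ℕ} (hc : ∀ D, f D ≤ c) {k : ℕ} {X Y : Finset α}
    (h : Relation.ReflTransGen (Step (Cheap F f k)) X Y) :
    ReachIn (Step (Cheap F f k)) (2 * (c + 1) * Fintype.card α) X Y := by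
  rcases h.cases_head with rfl | ⟨W, hW, -⟩
  · exact .refl _ _
  have hX := hW.1
  have hY := Step.reflTransGen_right hX h
  have sm : ∀ A B, Step (Cheap F f k) A B → Step (Cheap F f k) B A := fun _ _ => Step.symm
  obtain ⟨X', hX', hmX, hXX⟩ := exists_reach_isLocalMin hF hf c X (hc X) hX
  obtain ⟨Y', hY', hmY, hYY⟩ := exists_reach_isLocalMin hF hf c Y (hc Y) hY
  have hXY : Relation.ReflTransGen (Step (Cheap F f k)) X' Y' :=
    ((Step.reflTransGen_symm hXX.reflTransGen).trans h).trans hYY.reflTransGen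
  have h1 := hmX.reachIn_union hF hf hX' hmY hXY
  have h2 := hmY.reachIn_union hF hf hY' hmX (Step.reflTransGen_symm hXY)
  rw [Finset.union_comm] at h2
  exact (((hXX.trans h1).trans (h2.symm sm)).trans (hYY.symm sm)).mono (le_of_eq (by ring))

end Lattice
end SeparatorReconfig

namespace SeparatorReconfig

/-! ### Reconfiguration sequences as lists -/

section Lists

variable {V : Type*} {G : SimpleGraph V} {s t : V} {R : Finset V → Finset V → Prop}

theorem Reconfigurable.reflTransGen {S T : Finset V} (h : Reconfigurable G s t R S T) :
    Relation.ReflTransGen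
      (fun X Y => IsSeparator G s t X ∧ IsSeparator G s t Y ∧ R X Y) S T := by
  obtain ⟨L, hL⟩ := h
  induction L generalizing S with
  | nil => simpa using hL.head
  | cons A L ih =>
    obtain ⟨hsep, hch, hh, hl⟩ := hL
    obtain rfl : A = S := by simpa using hh
    cases L with
    | nil =>
      obtain rfl : A = T := by simpa using hl
      exact .refl
    | cons B L =>
      rw [List.isChain_cons_cons] at hch
      refine .head ⟨hsep A (by simp), hsep B (by simp), hch.1⟩ (ih ⟨?_, hch.2, rfl, ?_⟩)
      · exact fun X hX => hsep X (List.mem_cons_of_mem _ hX)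
      · rwa [List.getLast?_cons_cons] at hl

/-- Stationary steps are dropped. The bound is `m + 1` because length counts sets, not moves. -/
theorem ReachIn.exists_isReconfigSeq {r : Finset V → Finset V → Prop}
    (hr : ∀ X Y, r X Y → X = Y ∨ IsSeparator G s t Y ∧ R X Y) {m : ℕ} {S T : Finset V}
    (h : ReachIn r m S T) (hS : IsSeparator G s t S) :
    ∃ L, IsReconfigSeq G s t R S T L ∧ L.length ≤ m + 1 := by
  induction h with
  | refl m S => exact ⟨[S], ⟨by simpa using hS, by simp, rfl, rfl⟩, by simp⟩
  | @head m X Y Z hXY _ ih =>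
    rcases hr _ _ hXY with rfl | ⟨hY, hR⟩
    · obtain ⟨L, hL, hlen⟩ := ih hS
      exact ⟨L, hL, by omega⟩
    · obtain ⟨L, ⟨hsep, hch, hh, hl⟩, hlen⟩ := ih hY
      cases L with
      | nil => simp at hh
      | cons B L =>
        obtain rfl : B = Y := by simpa using hh
        refine ⟨X :: B :: L, ⟨?_, List.isChain_cons_cons.2 ⟨hR, hch⟩, rfl, ?_⟩, ?_⟩
        · intro D hD
          rcases List.mem_cons.1 hD with rfl | hD
          · exact hS
          · exact hsep D hD
        · rwa [List.getLast?_cons_cons]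
        · simpa using hlen

theorem IsSeparator.superset {S T : Finset V} (h : IsSeparator G s t S) (hST : S ⊆ T)
    (hs : s ∉ T) (ht : t ∉ T) : IsSeparator G s t T := by
  obtain ⟨_, _, h⟩ := h
  exact ⟨hs, ht, fun hr => h (hr.map
    (SimpleGraph.induceHomOfLE G (s := {x | x ∉ T}) (s' := {x | x ∉ S})
      fun _ hx hxS => hx (hST hxS)).toHom)⟩

end Lists

/-! ### From addition/removal to token jumping -/

section TokenJumping

variable {V : Type*} [DecidableEq V] {G : SimpleGraph V} {s t : V}

/-- One token jump between separators of size `k`. -/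
def JumpStep (G : SimpleGraph V) (s t : V) (k : ℕ) (X Y : Finset V) : Prop :=
  IsSeparator G s t X ∧ IsSeparator G s t Y ∧ X.card = k ∧ TJ X Y

/-- Tokens outside the common separator `Y` can be swapped freely: every intermediate set contains
`Y` and avoids the foci. -/
theorem reachIn_jumpStep_of_superset {k : ℕ} {Y X' : Finset V} (hY : IsSeparator G s t Y)
    (hX' : IsSeparator G s t X') (hYX' : Y ⊆ X') (hk' : X'.card = k) (c : ℕ) :
    ∀ X, IsSeparator G s t X → Y ⊆ X → X.card = k → (X' \ X).card = c →
      ReachIn (JumpStep G s t k) c X X' := by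
  induction c with
  | zero =>
    intro X _ _ hk h
    have hsub : X' ⊆ X := Finset.sdiff_eq_empty_iff_subset.1 (Finset.card_eq_zero.1 h)
    rw [Finset.eq_of_subset_of_card_le hsub (by omega)]
    exact .refl _ _
  | succ c ih =>
    intro X hX hYX hk h
    have hcard : (X \ X').card = c + 1 := by
      rw [Finset.card_sdiff_comm (by omega), h]
    obtain ⟨b, hb⟩ : (X' \ X).Nonempty := Finset.card_pos.1 (by omega)
    obtain ⟨a, ha⟩ : (X \ X').Nonempty := Finset.card_pos.1 (by omega)
    rw [Finset.mem_sdiff] at ha hb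
    have hab : a ≠ b := fun e => hb.2 (e ▸ ha.1)
    have hbe : b ∉ X.erase a := fun hm => hb.2 (Finset.mem_of_mem_erase hm)
    have hpos : 0 < X.card := Finset.card_pos.2 ⟨a, ha.1⟩
    have hZc : (insert b (X.erase a)).card = k := by
      rw [Finset.card_insert_of_notMem hbe, Finset.card_erase_of_mem ha.1]
      omega
    have hYZ : Y ⊆ insert b (X.erase a) := fun y hy =>
      Finset.mem_insert_of_mem
        (Finset.mem_erase.2 ⟨fun e => ha.2 (e ▸ hYX' hy), hYX hy⟩)
    have avoid : ∀ x, x ∉ X → x ∉ X' → x ∉ insert b (X.erase a) := by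
      intro x h1 h2 h3
      rcases Finset.mem_insert.1 h3 with rfl | h3
      · exact h2 hb.1
      · exact h1 (Finset.mem_of_mem_erase h3)
    have hZ : IsSeparator G s t (insert b (X.erase a)) :=
      hY.superset hYZ (avoid s hX.1 hX'.1) (avoid t hX.2.1 hX'.2.1)
    refine .head ⟨hX, hZ, hk, by omega, ?_, ?_⟩ (ih _ hZ hYZ hZc ?_)
    · rw [Finset.card_eq_one]
      refine ⟨a, ?_⟩
      ext x
      simp only [Finset.mem_sdiff, Finset.mem_insert, Finset.mem_erase, Finset.mem_singleton]
      constructor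
      · tauto
      · rintro rfl
        exact ⟨ha.1, by tauto⟩
    · rw [Finset.card_eq_one]
      refine ⟨b, ?_⟩
      ext x
      simp only [Finset.mem_sdiff, Finset.mem_insert, Finset.mem_erase, Finset.mem_singleton]
      constructor
      · tauto
      · rintro rfl
        exact ⟨.inl rfl, hb.2⟩
    · have : X' \ insert b (X.erase a) = (X' \ X).erase b := by
        ext x
        simp only [Finset.mem_sdiff, Finset.mem_insert, Finset.mem_erase]
        constructor
        · rintro ⟨h1, h2⟩
          have : x ≠ a := fun e => ha.2 (e ▸ h1)
          tauto
        · tauto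
      rw [this, Finset.card_erase_of_mem (Finset.mem_sdiff.2 hb), h, Nat.add_sub_cancel]

/-- `X'` is a separator of size `k` that contains `X` or is contained in `X`. -/
def IsPadding (G : SimpleGraph V) (s t : V) (k : ℕ) (X X' : Finset V) : Prop :=
  IsSeparator G s t X' ∧ X'.card = k ∧ (X ⊆ X' ∨ X' ⊆ X)

omit [DecidableEq V] in
theorem IsPadding.superset {k : ℕ} {X X' : Finset V} (h : IsPadding G s t k X X')
    (hX : X.card ≤ k) : X ⊆ X' := by
  obtain ⟨-, hk, h | h⟩ := h
  · exact h
  · exact (Finset.eq_of_subset_of_card_le h (by omega)).ge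

omit [DecidableEq V] in
theorem IsPadding.subset {k : ℕ} {X X' : Finset V} (h : IsPadding G s t k X X')
    (hX : k ≤ X.card) : X' ⊆ X := by
  obtain ⟨-, hk, h | h⟩ := h
  · exact (Finset.eq_of_subset_of_card_le h (by omega)).ge
  · exact h

variable [Fintype V]

theorem IsPadding.reachIn {k : ℕ} {X X₁ X₂ : Finset V} (hX : IsSeparator G s t X)
    (hXk : X.card ≤ k + 1) (h₁ : IsPadding G s t k X X₁) (h₂ : IsPadding G s t k X X₂) :
    ReachIn (JumpStep G s t k) (Fintype.card V) X₁ X₂ := by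
  rcases Nat.lt_or_ge k X.card with hlt | hle
  · have s₁ := h₁.subset hlt.le
    have s₂ := h₂.subset hlt.le
    have hu : (X₁ ∪ X₂).card ≤ k + 1 := (Finset.card_le_card (Finset.union_subset s₁ s₂)).trans hXk
    have hd₁ := Finset.card_sdiff_add_card X₁ X₂
    have hd₂ := Finset.card_sdiff_add_card X₂ X₁
    rw [Finset.union_comm] at hd₂
    have e₁ := h₁.2.1
    have e₂ := h₂.2.1
    -- Two `k`-subsets of a set of size at most `k + 1` are equal or one jump apart.
    by_cases he : X₁ ⊆ X₂
    · rw [Finset.eq_of_subset_of_card_le he (by omega)]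
      exact .refl _ _
    · have hpos : 0 < (X₁ \ X₂).card := Finset.card_pos.2 (Finset.sdiff_nonempty.2 he)
      have hV : 1 ≤ Fintype.card V := hpos.trans_le (Finset.card_le_univ _)
      exact (ReachIn.single ⟨h₁.1, h₂.1, e₁, by omega, by omega, by omega⟩).mono hV
  · exact (reachIn_jumpStep_of_superset hX h₂.1 (h₂.superset hle) h₂.2.1 _ X₁ h₁.1
      (h₁.superset hle) h₁.2.1 rfl).mono (Finset.card_le_univ _)

/-- If `L` has size `k + 1`, then `M` has size `k` and serves for both; otherwise any padding of `L`
does. -/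
theorem exists_common_padding_of_subset {k : ℕ} {X L M : Finset V}
    (hX : IsSeparator G s t X) (hXk : X.card = k) (hL : IsSeparator G s t L)
    (hM : IsSeparator G s t M) (hLk : L.card ≤ k + 1) (hML : M ⊆ L) (hne : L ≠ M)
    (hs : (L \ M).card ≤ 1) :
    ∃ X', IsPadding G s t k L X' ∧ IsPadding G s t k M X' := by
  have hc := Finset.card_sdiff_add_card_eq_card hML
  have hlt := Finset.card_lt_card (hML.ssubset_of_ne hne.symm)
  rcases Nat.lt_or_ge k L.card with hlt' | hle
  · exact ⟨M, ⟨hM, by omega, .inr hML⟩, hM, by omega, .inl subset_rfl⟩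
  · have sub : ∀ D, IsSeparator G s t D → D ⊆ {s, t}ᶜ := by
      intro D hD x hx
      simp only [Finset.mem_compl, Finset.mem_insert, Finset.mem_singleton, not_or]
      exact ⟨fun e => hD.1 (e ▸ hx), fun e => hD.2.1 (e ▸ hx)⟩
    -- The separator `X` witnesses that at least `k` vertices other than the foci are available.
    obtain ⟨Z, hLZ, hZ, hZk⟩ := Finset.exists_subsuperset_card_eq (sub L hL) hle
      (hXk ▸ Finset.card_le_card (sub X hX))
    have hsZ : s ∉ Z := fun h => by simpa using hZ h
    have htZ : t ∉ Z := fun h => by simpa using hZ h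
    have hZs := hL.superset hLZ hsZ htZ
    exact ⟨Z, ⟨hZs, hZk, .inl hLZ⟩, hZs, hZk, .inl (hML.trans hLZ)⟩

theorem reachIn_jumpStep {k m : ℕ} {S T : Finset V}
    (h : ReachIn (Step fun X => IsSeparator G s t X ∧ X.card ≤ k + 1) m S T)
    (hT : T.card = k) : ∀ X, IsPadding G s t k S X →
      ReachIn (JumpStep G s t k) (m * Fintype.card V) X T := by
  induction h with
  | refl m T =>
    intro X hX
    rw [(hX.subset hT.ge).antisymm (hX.superset hT.le)]
    exact .refl _ _
  | @head m A B T hAB _ ih =>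
    intro X hX
    obtain ⟨hA, hB, hd⟩ := hAB
    obtain ⟨X', hX'A, hX'B⟩ : ∃ X', IsPadding G s t k A X' ∧ IsPadding G s t k B X' := by
      rcases eq_or_ne A B with rfl | hne
      · exact ⟨X, hX, hX⟩
      have hsum : (A ∆ B).card = (A \ B).card + (B \ A).card :=
        Finset.card_union_of_disjoint disjoint_sdiff_sdiff
      rcases Nat.eq_zero_or_pos (A \ B).card with h0 | hpos
      · have hsub := Finset.sdiff_eq_empty_iff_subset.1 (Finset.card_eq_zero.1 h0)
        obtain ⟨X', h1, h2⟩ := exists_common_padding_of_subset hX.1 hX.2.1 hB.1 hA.1 hB.2 hsub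
          hne.symm (by omega)
        exact ⟨X', h2, h1⟩
      · have hsub := Finset.sdiff_eq_empty_iff_subset.1
          (Finset.card_eq_zero.1 (show (B \ A).card = 0 by omega))
        exact exists_common_padding_of_subset hX.1 hX.2.1 hA.1 hB.1 hA.2 hsub hne (by omega)
    refine ((hX.reachIn hA.1 hA.2 hX'A).trans (ih hT X' hX'B)).mono ?_
    rw [Nat.succ_mul, add_comm]

end TokenJumping

/-! ### Separators of peanut-like graphs -/

section Peanut

variable {V : Type*} {G : SimpleGraph V} {A B : Set V} {u v : V}

theorem IsPeanutLikeWith.isSeparator_iff (h : IsPeanutLikeWith G A B u v) (S : Finset V) :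
    IsSeparator G u v S ↔ u ∉ S ∧ v ∉ S ∧
      ∀ a ∈ A, ∀ b ∈ B, a ≠ v → b ≠ u → G.Adj a b → a ∈ S ∨ b ∈ S := by
  have adj_u : ∀ x, G.Adj u x ↔ x ∈ A ∧ x ≠ v := fun x => by
    rw [← SimpleGraph.mem_neighborSet, h.neighbors_left]
    simp
  have adj_v : ∀ x, G.Adj v x ↔ x ∈ B ∧ x ≠ u := fun x => by
    rw [← SimpleGraph.mem_neighborSet, h.neighbors_right]
    simp
  have hdisj : ∀ x, x ∈ A → x ∉ B := fun x hA hB => Set.disjoint_left.1 h.bipartite.disjoint hA hB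
  constructor
  · rintro ⟨hu, hv, hr⟩
    refine ⟨hu, hv, fun a ha b hb hav hbu hab => ?_⟩
    by_contra! hS
    refine hr (SimpleGraph.Reachable.trans (v := ⟨a, hS.1⟩) (SimpleGraph.Adj.reachable ?_)
      (SimpleGraph.Reachable.trans (v := ⟨b, hS.2⟩) (SimpleGraph.Adj.reachable ?_)
        (SimpleGraph.Adj.reachable ?_)))
    · exact (adj_u a).2 ⟨ha, hav⟩
    · exact hab
    · exact ((adj_v b).2 ⟨hb, hbu⟩).symm
  · rintro ⟨hu, hv, hS⟩
    refine ⟨hu, hv, fun ⟨p⟩ => ?_⟩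
    -- A walk from `u` avoiding `S` never leaves `{u} ∪ (A \ {v})`: from a vertex of `A \ {v}` it
    -- can only return to `u`.
    have key : ∀ {x y : {x | x ∉ S}}, (G.induce {x | x ∉ S}).Walk x y →
        (x.1 = u ∨ x.1 ∈ A ∧ x.1 ≠ v) → (y.1 = u ∨ y.1 ∈ A ∧ y.1 ≠ v) := by
      intro x y p
      induction p with
      | nil => exact id
      | @cons x y z hxy _ ih =>
        intro hx
        apply ih
        have hxy' : G.Adj x.1 y.1 := hxy
        rcases hx with hx | ⟨hxA, hxv⟩
        · exact .inr ((adj_u _).1 (hx ▸ hxy'))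
        · have hyB : y.1 ∈ B := h.bipartite.mem_of_mem_adj hxA hxy'
          by_contra! hy
          rcases hS _ hxA _ hyB hxv hy.1 hxy' with h' | h'
          · exact x.2 h'
          · exact y.2 h'
    rcases key p (.inl rfl) with h' | h'
    · exact hdisj _ h.mem_right (by rw [show v = u from h']; exact h.mem_left)
    · exact h'.2 rfl

variable [DecidableEq V] [Fintype V]

theorem isModular_card_symmDiff (B : Finset V) : IsModular fun D => (D ∆ B).card := by
  intro X Y
  have hcard : ∀ D : Finset V, (D ∆ B).card = ∑ x, if x ∈ D ∆ B then 1 else 0 := fun D => by simp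
  simp only [hcard, ← Finset.sum_add_distrib]
  refine Finset.sum_congr rfl fun x _ => ?_
  by_cases hX : x ∈ X <;> by_cases hY : x ∈ Y <;> by_cases hB : x ∈ B <;>
    simp [Finset.mem_symmDiff, hX, hY, hB]

omit [Fintype V] in
theorem IsPeanutLikeWith.isSetLattice (h : IsPeanutLikeWith G A B u v) {B' : Finset V}
    (hB' : ∀ x, x ∈ B' ↔ x ∈ B) : IsSetLattice fun D => IsSeparator G u v (D ∆ B') := by
  have hdisj : ∀ x, x ∈ A → x ∉ B := fun x hA hB => Set.disjoint_left.1 h.bipartite.disjoint hA hB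
  have key : ∀ D : Finset V, IsSeparator G u v (D ∆ B') ↔ u ∈ D ∧ v ∉ D ∧
      ∀ a ∈ A, ∀ b ∈ B, a ≠ v → b ≠ u → G.Adj a b → b ∈ D → a ∈ D := by
    intro D
    have memA : ∀ a ∈ A, (a ∈ D ∆ B' ↔ a ∈ D) := fun a ha => by
      have := hdisj a ha
      simp only [Finset.mem_symmDiff, hB']
      tauto
    have memB : ∀ b ∈ B, (b ∈ D ∆ B' ↔ b ∉ D) := fun b hb => by
      simp only [Finset.mem_symmDiff, hB']
      tauto
    rw [h.isSeparator_iff, memB u h.mem_left, memA v h.mem_right, not_not]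
    refine and_congr_right fun _ => and_congr_right fun _ =>
      forall₂_congr fun a ha => forall₂_congr fun b hb => ?_
    rw [memA a ha, memB b hb]
    tauto
  intro X Y hX hY
  rw [key] at hX hY
  simp only [key, Finset.mem_union, Finset.mem_inter]
  obtain ⟨hX1, hX2, hX3⟩ := hX
  obtain ⟨hY1, hY2, hY3⟩ := hY
  refine ⟨⟨.inl hX1, by tauto, fun a ha b hb h1 h2 h3 => ?_⟩,
    ⟨hX1, hY1⟩, by tauto, fun a ha b hb h1 h2 h3 => ?_⟩
  · exact Or.imp (hX3 a ha b hb h1 h2 h3) (hY3 a ha b hb h1 h2 h3)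
  · exact And.imp (hX3 a ha b hb h1 h2 h3) (hY3 a ha b hb h1 h2 h3)

theorem IsPeanutLike.reachIn (h : IsPeanutLike G u v) {k : ℕ} {S T : Finset V}
    (hST : Relation.ReflTransGen (Step fun X => IsSeparator G u v X ∧ X.card ≤ k) S T) :
    ReachIn (Step fun X => IsSeparator G u v X ∧ X.card ≤ k)
      (2 * (Fintype.card V + 1) * Fintype.card V) S T := by
  classical
  obtain ⟨A, B, h⟩ := h
  let B' : Finset V := {x | x ∈ B}
  have hB' : ∀ x, x ∈ B' ↔ x ∈ B := by simp [B']
  have hcancel : ∀ X : Finset V, X ∆ B' ∆ B' = X := fun X => symmDiff_symmDiff_cancel_right _ _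
  have hdiff : ∀ X Y : Finset V, (X ∆ B') ∆ (Y ∆ B') = X ∆ Y := fun X Y => by
    rw [symmDiff_symmDiff_symmDiff_comm, symmDiff_self, symmDiff_bot]
  have hlift := hST.lift (p := Step (Cheap (fun D => IsSeparator G u v (D ∆ B'))
    (fun D => (D ∆ B').card) k)) (fun D => D ∆ B') fun X Y hXY => by
      refine ⟨?_, ?_, ?_⟩
      · simpa only [Cheap, hcancel] using hXY.1
      · simpa only [Cheap, hcancel] using hXY.2.1
      · simpa only [hdiff] using hXY.2.2
  have := (reachIn_of_reflTransGen (h.isSetLattice hB') (isModular_card_symmDiff B')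
    (fun D => Finset.card_le_univ _) hlift).map
    (s := Step fun X => IsSeparator G u v X ∧ X.card ≤ k) (fun D => D ∆ B')
    fun X Y hXY => ⟨hXY.1, hXY.2.1, by simpa only [hdiff] using hXY.2.2⟩
  simpa only [hcancel] using this

theorem IsPeanutLike.exists_isReconfigSeq_TAR (h : IsPeanutLike G u v) {k : ℕ} {S T : Finset V}
    (hS : IsSeparator G u v S) (hST : Reconfigurable G u v (TAR k) S T) :
    ∃ L, IsReconfigSeq G u v (TAR k) S T L ∧
      L.length ≤ 2 * (Fintype.card V + 1) * Fintype.card V + 1 := by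
  have hr : Relation.ReflTransGen (Step fun X => IsSeparator G u v X ∧ X.card ≤ k) S T :=
    hST.reflTransGen.lift id fun X Y ⟨hX, hY, h1, h2⟩ =>
      ⟨⟨hX, (le_max_left _ _).trans h2⟩, ⟨hY, (le_max_right _ _).trans h2⟩, h1.le⟩
  refine (h.reachIn hr).exists_isReconfigSeq (fun X Y hXY => ?_) hS
  obtain ⟨hX, hY, hd⟩ := hXY
  rcases Nat.eq_zero_or_pos (X ∆ Y).card with h0 | hpos
  · exact .inl (symmDiff_eq_bot.1 (Finset.card_eq_zero.1 h0))
  · exact .inr ⟨hY.1, le_antisymm hd hpos, max_le hX.2 hY.2⟩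

/-- A jump from `X` to `Y` passes through `X ∪ Y`, a separator of size `k + 1`. -/
theorem reflTransGen_step_of_TJ {k : ℕ} {S T : Finset V} (hSk : S.card = k)
    (hST : Reconfigurable G u v TJ S T) : T.card = k ∧
      Relation.ReflTransGen (Step fun X => IsSeparator G u v X ∧ X.card ≤ k + 1) S T := by
  have hr := hST.reflTransGen
  clear hST
  induction hr with
  | refl => exact ⟨hSk, .refl⟩
  | @tail X Y _ hXY ih =>
    obtain ⟨hX, hY, hc, h1, h2⟩ := hXY
    obtain ⟨hXk, ih⟩ := ih
    have hu := Finset.card_sdiff_add_card X Y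
    have hU : IsSeparator G u v (X ∪ Y) := hX.superset Finset.subset_union_left
      (by simpa using ⟨hX.1, hY.1⟩) (by simpa using ⟨hX.2.1, hY.2.1⟩)
    refine ⟨by omega, (ih.tail (b := X) (c := X ∪ Y) ⟨⟨hX, by omega⟩, ⟨hU, by omega⟩, ?_⟩).tail
      ⟨⟨hU, by omega⟩, ⟨hY, by omega⟩, ?_⟩⟩
    · rw [symmDiff_of_le (show X ≤ X ∪ Y from Finset.subset_union_left),
        Finset.union_sdiff_left]
      exact h2.le
    · rw [symmDiff_of_ge (show Y ≤ X ∪ Y from Finset.subset_union_right),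
        Finset.union_sdiff_right]
      exact h1.le

theorem IsPeanutLike.exists_isReconfigSeq_TJ (h : IsPeanutLike G u v) {S T : Finset V}
    (hS : IsSeparator G u v S) (hST : Reconfigurable G u v TJ S T) :
    ∃ L, IsReconfigSeq G u v TJ S T L ∧
      L.length ≤ 2 * (Fintype.card V + 1) * Fintype.card V * Fintype.card V + 1 := by
  obtain ⟨hT, hr⟩ := reflTransGen_step_of_TJ rfl hST
  exact (reachIn_jumpStep (h.reachIn hr) hT S ⟨hS, rfl, .inl subset_rfl⟩).exists_isReconfigSeq
    (fun X Y hXY => .inr ⟨hXY.2.1, hXY.2.2.2⟩) hS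

end Peanut

end SeparatorReconfig

theorem mainTheorem11 :
    ∃ C : ℕ, ∀ (V : Type*) [Fintype V] [DecidableEq V] (H : SimpleGraph V) (u v : V)
      (Sa Sb : Finset V),
      SeparatorReconfig.IsPeanutLike H u v →
      SeparatorReconfig.IsSeparator H u v Sa →
      SeparatorReconfig.IsSeparator H u v Sb →
      (SeparatorReconfig.Reconfigurable H u v SeparatorReconfig.TJ Sa Sb →
        ∃ L : List (Finset V),
          SeparatorReconfig.IsReconfigSeq H u v SeparatorReconfig.TJ Sa Sb L ∧
            L.length ≤ C * Fintype.card V ^ 4) ∧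
      (∀ k : ℕ, SeparatorReconfig.Reconfigurable H u v (SeparatorReconfig.TAR k) Sa Sb →
        ∃ L : List (Finset V),
          SeparatorReconfig.IsReconfigSeq H u v (SeparatorReconfig.TAR k) Sa Sb L ∧
            L.length ≤ C * Fintype.card V ^ 4) := by

  -- `5 = 2 + 2 + 1`: the bounds are `2n³ + 2n² + 1` for TJ and `2n² + 2n + 1` for TAR, with `n ≥
  -- 1`.
  refine ⟨5, fun V _ _ H u v Sa Sb h hSa _ => ?_⟩
  have hn : 1 ≤ Fintype.card V := Fintype.card_pos_iff.2 ⟨u⟩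
  generalize hN : Fintype.card V = n at hn
  have h2 : n ^ 2 ≤ n ^ 4 := Nat.pow_le_pow_right hn (by norm_num)
  have h3 : n ^ 3 ≤ n ^ 4 := Nat.pow_le_pow_right hn (by norm_num)
  have h1 : n ≤ n ^ 4 := Nat.le_self_pow (by norm_num) n
  refine ⟨fun hST => ?_, fun k hST => ?_⟩
  · obtain ⟨L, hL, hlen⟩ := h.exists_isReconfigSeq_TJ hSa hST
    rw [hN] at hlen
    exact ⟨L, hL, hlen.trans (by ring_nf; omega)⟩
  · obtain ⟨L, hL, hlen⟩ := h.exists_isReconfigSeq_TAR hSa hST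
    rw [hN] at hlen
    exact ⟨L, hL, hlen.trans (by ring_nf; omega)⟩
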